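/- Let $K$ be a field, $x=(x_1,\dots,x_n)$ indeterminates with formal rational powers, $\overline x_i=x_i^{-1}$. For $G=Sp(2n)$, $SO(2n+1)$, $SO(2n)$ and a dominant weight $\kappa$, let $$\mathrm{ch}^G_\kappa=\sum_{w\in W_G}\mathrm{sgn}(w)\,x^{w(\kappa+\rho_G)}\Big/\sum_{w\in W_G}\mathrm{sgn}(w)\,x^{w(\rho_G)}$$ be the irreducible character given by Weyl's formula (half-integral $\kappa$ are allowed for the orthogonal groups and give characters of the spin covers), and let $\mathrm{ch}^{O(2n)}_\kappa=\mathrm{ch}^{SO(2n)}_\kappa$ if $\kappa_n=0$ and $\mathrm{ch}^{O(2n)}_\kappa=\mathrm{ch}^{SO(2n)}_{\kappa}+\mathrm{ch}^{SO(2n)}_{(\kappa_1,\dots,\kappa_{n-1},-\kappa_n)}$ otherwise. For $G=Sp(2n)$ or $SO(2n+1)$ define the (ordinary) expansion coefficients $\phi^G_r$ and $\psi^G_{q,r}$ by $$\prod_{i=1}^n\bigl(a_0+a_1(x_i+\overline x_i)\bigr)=\sum_{q+r=n}a_1^q\,\phi^{G}_r(a_0,a_1)\,\mathrm{ch}^G_{(1^q,0^r)},$$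 $$\prod_{i=1}^n\bigl(a_0+a_1(x_i+\overline x_i)+a_2(x_i^2+\overline x_i^2)\bigr)=\sum_{p+q+r=n}a_2^p\,\psi^{G}_{q,r}(a_0,a_1,a_2)\,\mathrm{ch}^G_{(2^p,1^q,0^r)},$$ and for $G=SO(2n+1)$ or $O(2n)$ define the spin expansion coefficients $\phi^{G,\mathrm{spin}}_r$ and $\psi^{G,\mathrm{spin}}_{q,r}$ by $$\prod_{i=1}^n\bigl(a_{1/2}(x_i^{1/2}+\overline x_i^{1/2})+a_{3/2}(x_i^{3/2}+\overline x_i^{3/2})\bigr)=\sum_{q+r=n}a_{3/2}^q\,\phi^{G,\mathrm{spin}}_r(a_{1/2},a_{3/2})\,\mathrm{ch}^G_{((3/2)^q,(1/2)^r)},$$ $$\prod_{i=1}^n\bigl(a_{1/2}(x_i^{1/2}+\overline x_i^{1/2})+a_{3/2}(x_i^{3/2}+\overline x_i^{3/2})+a_{5/2}(x_i^{5/2}+\overline x_i^{5/2})\bigr)=\sum_{p+q+r=n}a_{5/2}^p\,\psi^{G,\mathrm{spin}}_{q,r}(a_{1/2},a_{3/2},a_{5/2})\,\mathrm{ch}^G_{((5/2)^p,(3/2)^q,(1/2)^r)}.$$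 If the last parameter ($a_1$, $a_2$, $a_{3/2}$ or $a_{5/2}$, respectively) equals $1$, then in each of these eight cases there is exactly one family $(\phi_r)_{r\ge0}$, respectively $(\psi_{q,r})_{q,r\ge0}$, of elements of $K$, independent of $n$, for which the expansion holds for all $n\ge1$. Moreover, for every $n\ge1$, all $a,b\in K$ and all $q,r\ge0$ with $r\le n$ (respectively $q+r\le n$), any coefficients for which the corresponding rank-$n$ expansions hold satisfy $$\phi_r^{SO(2n+1),\mathrm{spin}}(a,1)=\phi_r^{Sp(2n)}(a-1,1),$$ $$\phi_r^{O(2n),\mathrm{spin}}(a,1)=(-1)^r\,\phi_r^{SO(2n+1)}(1-a,1),$$ $$\psi_{q,r}^{SO(2n+1),\mathrm{spin}}(a,b,1)=\psi_{q,r}^{Sp(2n)}(a-b+1,\,b-1,\,1),$$ $$\psi_{q,r}^{O(2n),\mathrm{spin}}(a,b,1)=(-1)^q\,\psi_{q,r}^{SO(2n+1)}(a-b+1,\,1-b,\,1).$$ -/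

import Mathlib

noncomputable section

/-- The three families of groups of rank `n` whose irreducible characters are given by
Weyl's formula below: `Sp(2n)`, `SO(2n+1)` and `SO(2n)`. -/
inductive ClassicalFamily : Type
  | sp
  | soOdd
  | soEven

/-- The field of fractions of the group algebra of `ℚⁿ` over `K`. The formal exponential of a weight
`κ = (κ₁, …, κₙ)` is the monomial `x^κ = x₁^κ₁ ⋯ xₙ^κₙ`; half-integral exponents are allowed. -/
abbrev CharField (K : Type*) [Field K] (n : ℕ) : Type _ :=
  FractionRing (AddMonoidAlgebra K (Fin n → ℚ))

/-- The monomial `x^κ`. -/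
def xMonomial (K : Type*) [Field K] {n : ℕ} (κ : Fin n → ℚ) : CharField K n :=
  algebraMap (AddMonoidAlgebra K (Fin n → ℚ)) (CharField K n) (AddMonoidAlgebra.single κ 1)

/-- `x_i^k + x_i^{-k}`. -/
def xSym (K : Type*) [Field K] {n : ℕ} (i : Fin n) (k : ℚ) : CharField K n :=
  xMonomial K (Pi.single i k) + xMonomial K (Pi.single i (-k))

/-- The Weyl vector `ρ`, half the sum of the positive roots. The index `i` is `0`-based, so that the
components are `n, …, 1` for `Sp(2n)`, `n - 1/2, …, 1/2` for `SO(2n+1)` and `n - 1, …, 0`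
for `SO(2n)`. -/
def weylVector (G : ClassicalFamily) (n : ℕ) (i : Fin n) : ℚ :=
  match G with
  | .sp => (n : ℚ) - (i : ℕ)
  | .soOdd => (n : ℚ) - 1 / 2 - (i : ℕ)
  | .soEven => (n : ℚ) - 1 - (i : ℕ)

/-- Signed permutations: `(σ, ε)` permutes the components of a weight by `σ` and then changes
signs according to `ε`. -/
abbrev SignedPerm (n : ℕ) : Type := Equiv.Perm (Fin n) × (Fin n → ℤˣ)

/-- The action of a signed permutation on weights. -/
def SignedPerm.act {n : ℕ} (w : SignedPerm n) (κ : Fin n → ℚ) : Fin n → ℚ :=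
  fun i => (((w.2 i : ℤˣ) : ℤ) : ℚ) * κ (w.1.symm i)

/-- The signature of a signed permutation, which is the determinant of its action on weights. -/
def SignedPerm.sgn {n : ℕ} (w : SignedPerm n) : ℤ :=
  ((Equiv.Perm.sign w.1 * ∏ i, w.2 i : ℤˣ) : ℤ)

/-- The Weyl group, as a finite set of signed permutations: all of them for `Sp(2n)` and `SO(2n+1)`,
those with an even number of sign changes for `SO(2n)`. -/
def weylGroup (G : ClassicalFamily) (n : ℕ) : Finset (SignedPerm n) :=
  match G with
  | .sp => Finset.univ
  | .soOdd => Finset.univ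
  | .soEven => Finset.univ.filter fun w => ∏ i, w.2 i = 1

/-- The alternating sum `∑_{w ∈ W} sgn(w) x^{w(κ)}`. -/
def alternant (K : Type*) [Field K] (G : ClassicalFamily) {n : ℕ} (κ : Fin n → ℚ) :
    CharField K n :=
  ∑ w ∈ weylGroup G n, w.sgn • xMonomial K (w.act κ)

/-- Weyl's character formula: the character of highest weight `κ` of `Sp(2n)`, `SO(2n+1)` or `SO(2n)`
(or of the spin covering group, for half-integral `κ`). -/
def weylChar (K : Type*) [Field K] (G : ClassicalFamily) {n : ℕ} (κ : Fin n → ℚ) :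
    CharField K n :=
  alternant K G (κ + weylVector G n) / alternant K G (weylVector G n)

/-- The character of `Sp(2n)` of highest weight `κ`, at a group element with eigenvalues
`(x, x⁻¹)`. -/
def chSp (K : Type*) [Field K] {n : ℕ} (κ : Fin n → ℚ) : CharField K n :=
  weylChar K .sp κ

/-- The character of `SO(2n+1)`, or of its spin covering group, of highest weight `κ`, at a group
element with eigenvalues `(x, x⁻¹, 1)`. -/
def chSOodd (K : Type*) [Field K] {n : ℕ} (κ : Fin n → ℚ) : CharField K n :=
  weylChar K .soOdd κ

/-- The weight obtained by changing the sign of the last component. -/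
def negLast {n : ℕ} (κ : Fin n → ℚ) : Fin n → ℚ :=
  fun i => if (i : ℕ) + 1 = n then -κ i else κ i

/-- The character of `O(2n)`, or of its spin covering group, of highest weight `κ`, at a group
element with eigenvalues `(x, x⁻¹)`: the restriction to `SO(2n)` is irreducible if the last component
of `κ` vanishes, and is the sum of two irreducibles, with opposite last components, otherwise. -/
def chOeven (K : Type*) [Field K] {n : ℕ} (κ : Fin n → ℚ) : CharField K n :=
  if negLast κ = κ then weylChar K .soEven κ
  else weylChar K .soEven κ + weylChar K .soEven (negLast κ)

/-- The weight `(2^p, 1^q, 0^r)` with `r = n - p - q`. -/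
def boxWeight (n p q : ℕ) : Fin n → ℚ :=
  fun i => if (i : ℕ) < p then 2 else if (i : ℕ) < p + q then 1 else 0

/-- The weight `Δ = (1/2, …, 1/2)` of the basic spin representation. -/
def spinWeight (n : ℕ) : Fin n → ℚ := fun _ => 1 / 2

/-- `∏ᵢ (a₀ + a₁ (xᵢ + xᵢ⁻¹)) = ∑_{q + r = n} a₁^q φ_r ch_{(1^q, 0^r)}`. -/
def IsPhi {K : Type*} [Field K] {n : ℕ} (ch : (Fin n → ℚ) → CharField K n)
    (a₀ a₁ : K) (φ : ℕ → K) : Prop :=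
  ∏ i : Fin n, (a₀ • (1 : CharField K n) + a₁ • xSym K i 1) =
    ∑ q ∈ Finset.range (n + 1), (a₁ ^ q * φ (n - q)) • ch (boxWeight n 0 q)

/-- `∏ᵢ (a_{1/2} (xᵢ^{1/2} + xᵢ^{-1/2}) + a_{3/2} (xᵢ^{3/2} + xᵢ^{-3/2}))
= ∑_{q + r = n} a_{3/2}^q φ_r ch_{((3/2)^q, (1/2)^r)}`. -/
def IsSpinPhi {K : Type*} [Field K] {n : ℕ} (ch : (Fin n → ℚ) → CharField K n)
    (a₁ a₃ : K) (φ : ℕ → K) : Prop :=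
  ∏ i : Fin n, (a₁ • xSym K i (1 / 2) + a₃ • xSym K i (3 / 2)) =
    ∑ q ∈ Finset.range (n + 1), (a₃ ^ q * φ (n - q)) • ch (spinWeight n + boxWeight n 0 q)

/-- `∏ᵢ (a₀ + a₁ (xᵢ + xᵢ⁻¹) + a₂ (xᵢ² + xᵢ⁻²))
= ∑_{p + q + r = n} a₂^p ψ_{q,r} ch_{(2^p, 1^q, 0^r)}`. -/
def IsPsi {K : Type*} [Field K] {n : ℕ} (ch : (Fin n → ℚ) → CharField K n)
    (a₀ a₁ a₂ : K) (ψ : ℕ → ℕ → K) : Prop :=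
  ∏ i : Fin n, (a₀ • (1 : CharField K n) + a₁ • xSym K i 1 + a₂ • xSym K i 2) =
    ∑ p ∈ Finset.range (n + 1), ∑ q ∈ Finset.range (n - p + 1),
      (a₂ ^ p * ψ q (n - p - q)) • ch (boxWeight n p q)

/-- `∏ᵢ (a_{1/2} (xᵢ^{1/2} + xᵢ^{-1/2}) + a_{3/2} (xᵢ^{3/2} + xᵢ^{-3/2})
+ a_{5/2} (xᵢ^{5/2} + xᵢ^{-5/2})) = ∑_{p + q + r = n} a_{5/2}^p ψ_{q,r} ch_{((5/2)^p, (3/2)^q, (1/2)^r)}`. -/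
def IsSpinPsi {K : Type*} [Field K] {n : ℕ} (ch : (Fin n → ℚ) → CharField K n)
    (a₁ a₃ a₅ : K) (ψ : ℕ → ℕ → K) : Prop :=
  ∏ i : Fin n, (a₁ • xSym K i (1 / 2) + a₃ • xSym K i (3 / 2) + a₅ • xSym K i (5 / 2)) =
    ∑ p ∈ Finset.range (n + 1), ∑ q ∈ Finset.range (n - p + 1),
      (a₅ ^ p * ψ q (n - p - q)) • ch (spinWeight n + boxWeight n p q)

end

/-! Put u_i = x_i + x_i⁻¹. The terms x^(k+h) + η x^(-k-h) satisfy f_{k+2} = u f_{k+1} - f_k, so they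
are p_k(u) (x^h + η x^(-h)) with monic p_k depending only on a boundary constant ε
(`xTwist_eq_aeval`): (h, η, ε) is (1, -1, 0) for Sp(2n), (1/2, -1, 1) for SO(2n+1) and (1/2, 1, -1)
for the spin case of O(2n). The alternants become, up to a common factor, determinants det
p_{m_j}(u_i), with the Vandermonde determinant for the zero weight.

The box weights correspond to exponent sets omitting one or two values from an initial segment of ℕ.
On the other side, ∏ P(u_i) times the Vandermonde is a determinant of size n + deg P whose extra
rows are functionals killing the multiples of P. Computing it in the basis p_k and expanding along
those rows gives a sum over the omitted exponents (`prod_mul_vandermonde_linear`,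
`prod_mul_vandermonde_quadratic`). Its coefficients involve only P and ε, hence are independent of
the rank; uniqueness is the linear independence in `coeff_eq_of_sum_signedSum_eq`.

In the spin cases ∏ (x_i^{1/2} + x_i^{-1/2}) factors out. For SO(2n+1) it turns the denominator into
that of Sp(2n), so both expansions coincide. For O(2n) it leads to ε = -1, and p_k for -ε is (-1)^k
p_k(-X) for ε, which accounts for the signs relative to SO(2n+1). -/

open Polynomial in
/-- The monic polynomials `p_k` with `p_0 = 1`, `p_1 = X + ε` and `p_{k+2} = X p_{k+1} - p_k`. -/
noncomputable def chebFamily {K : Type*} [CommRing K] (ε : K) : ℕ → K[X]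
  | 0 => 1
  | 1 => X + C ε
  | k + 2 => X * chebFamily ε (k + 1) - chebFamily ε k

/-! ### Determinants of monic polynomial sequences and Laplace expansion -/

section Polynomials

open Polynomial Matrix

variable {K : Type*} [Field K]

theorem chebFamily_monic_natDegree (ε : K) (k : ℕ) :
    (chebFamily ε k).Monic ∧ (chebFamily ε k).natDegree = k := by
  induction k using Nat.twoStepInduction with
  | zero => simp [chebFamily]
  | one => simp [chebFamily, monic_X_add_C]
  | more k h₀ h₁ =>
    have hm : (X * chebFamily ε (k + 1)).Monic := monic_X.mul h₁.1
    have hd : (X * chebFamily ε (k + 1)).natDegree = k + 2 := by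
      rw [monic_X.natDegree_mul h₁.1, h₁.2, natDegree_X]; ring
    have hlt : (chebFamily ε k).natDegree < (X * chebFamily ε (k + 1)).natDegree := by
      rw [hd, h₀.2]; omega
    refine ⟨hm.sub_of_left (degree_lt_degree hlt), ?_⟩
    rw [chebFamily, natDegree_sub_eq_left_of_natDegree_lt hlt, hd]

/-- The source of every sign in the relations between O(2n) spin and SO(2n+1): the recurrence is odd
in X, so only the initial term sees ε. -/
theorem chebFamily_neg (ε : K) (k : ℕ) :
    chebFamily (-ε) k = (-1) ^ k * (chebFamily ε k).comp (-X) := by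
  induction k using Nat.twoStepInduction with
  | zero => simp [chebFamily]
  | one => simp [chebFamily]; ring
  | more k h₀ h₁ =>
    simp only [chebFamily, h₀, h₁, sub_comp, mul_comp, X_comp]
    ring

/-- A sequence satisfying the recurrence of `chebFamily` is given by values of these polynomials. -/
theorem aeval_chebFamily_mul {R : Type*} [CommRing R] [Algebra K R] (ε : K) (u : R) (f : ℕ → R)
    (h₁ : f 1 = (u + algebraMap K R ε) * f 0) (h : ∀ k, f (k + 2) = u * f (k + 1) - f k) (k : ℕ) :
    aeval u (chebFamily ε k) * f 0 = f k := by
  induction k using Nat.twoStepInduction with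
  | zero => simp [chebFamily]
  | one => simp [chebFamily, h₁]
  | more k i₀ i₁ =>
    rw [h, ← i₀, ← i₁]
    simp only [chebFamily, map_sub, map_mul, aeval_X]
    ring

/-- The determinant of the values of linear functionals on a monic sequence of polynomials does not
depend on the sequence. -/
theorem det_linearMap_monic {R : Type*} [CommRing R] [Algebra K R] {n : ℕ}
    (l : Fin n → K[X] →ₗ[K] R) (b : ℕ → K[X]) (hm : ∀ k, (b k).Monic)
    (hd : ∀ k, (b k).natDegree = k) :
    det (of fun i j : Fin n => l i (b j)) = det (of fun i j : Fin n => l i (X ^ (j : ℕ))) := by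
  have h : (of fun i j : Fin n => l i (b j)) = (of fun i j : Fin n => l i (X ^ (j : ℕ))) *
      (of fun i j : Fin n => (b j).coeff i).map (algebraMap K R) := by
    ext i j
    have hb : b j = ∑ k : Fin n, (b j).coeff k • X ^ (k : ℕ) := by
      conv_lhs => rw [as_sum_range' (b j) n (by rw [hd]; exact j.2)]
      rw [Finset.sum_range]
      simp [smul_eq_C_mul, C_mul_X_pow_eq_monomial]
    simp only [of_apply, mul_apply, map_apply]
    conv_lhs => rw [hb]
    simp only [map_sum, map_smul]
    simp only [Algebra.smul_def]
    exact Finset.sum_congr rfl fun _ _ => mul_comm _ _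
  -- The change-of-basis matrix to powers of X is unitriangular.
  have h1 : (of fun i j : Fin n => (b j).coeff i).det = 1 :=
    det_matrixOfPolynomials (fun j : Fin n => b j) (fun j => hd j) (fun j => hm j)
  rw [h, det_mul, ← RingHom.mapMatrix_apply, ← RingHom.map_det, h1, map_one, mul_one]

/-- `det (b_{m_j}(u_i))`. -/
noncomputable def polyDet {R : Type*} [CommRing R] [Algebra K R] {n : ℕ} (b : ℕ → K[X])
    (u : Fin n → R) (m : Fin n → ℕ) : R :=
  det (of fun i j => aeval (u i) (b (m j)))

theorem polyDet_val {R : Type*} [CommRing R] [Algebra K R] {n : ℕ} (b : ℕ → K[X])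
    (hm : ∀ k, (b k).Monic) (hd : ∀ k, (b k).natDegree = k) (u : Fin n → R) :
    polyDet b u (fun j => j) = det (vandermonde u) := by
  have h := det_linearMap_monic (fun i => (aeval (u i) : K[X] →ₐ[K] R).toLinearMap) b hm hd
  simp only [AlgHom.toLinearMap_apply, map_pow, aeval_X] at h
  exact h

theorem det_row_mul_vandermonde {R : Type*} [CommRing R] [Algebra K R] {n : ℕ} (P : K[X])
    (u : Fin n → R) :
    det (of fun i j : Fin n => aeval (u i) (P * X ^ (j : ℕ))) =
      (∏ i, aeval (u i) P) * det (vandermonde u) := by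
  rw [← det_mul_column]
  congr 1
  ext i j
  simp [vandermonde]

/-- Skip the value `k`. -/
def skip (k j : ℕ) : ℕ := if j < k then j else j + 1

theorem succAbove_val {n : ℕ} (k : Fin (n + 1)) (j : Fin n) :
    ((k.succAbove j : Fin (n + 1)) : ℕ) = skip k j := by
  simp only [Fin.succAbove, skip, Fin.lt_def, Fin.val_castSucc]
  split_ifs <;> simp

theorem det_eq_of_first_row {R : Type*} [CommRing R] {n : ℕ}
    (M : Matrix (Fin (n + 1)) (Fin (n + 1)) R) (h₀ : M 0 0 = 1) (h : ∀ j : Fin n, M 0 j.succ = 0) :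
    M.det = (M.submatrix Fin.succ Fin.succ).det := by
  rw [det_succ_row_zero, Fin.sum_univ_succ]
  simp [h₀, h, Fin.succAbove_zero]

/-- Adjoin evaluation at the root -a as an extra row. In the basis 1, (X + a) X^k this row is (1, 0,
…, 0), leaving the left side; in the basis `b`, expansion along it gives the right side. -/
theorem prod_mul_vandermonde_linear {R : Type*} [CommRing R] [Algebra K R] {n : ℕ} (b : ℕ → K[X])
    (hm : ∀ k, (b k).Monic) (hd : ∀ k, (b k).natDegree = k) (u : Fin n → R) (a : K) :
    (∏ i, aeval (u i) (X + C a)) * det (vandermonde u) =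
      ∑ k ∈ Finset.range (n + 1),
        ((-1) ^ k * (b k).eval (-a)) • polyDet b u (fun j => skip k j) := by
  let l : Fin (n + 1) → K[X] →ₗ[K] R := Fin.cons
    ((Algebra.linearMap K R).comp (leval (-a)))
    (fun i => (aeval (u i) : K[X] →ₐ[K] R).toLinearMap)
  let e : ℕ → K[X] := fun k => match k with
    | 0 => 1
    | k + 1 => (X + C a) * X ^ k
  have hem : ∀ k, (e k).Monic := by
    rintro (_ | k)
    · exact monic_one
    · exact (monic_X_add_C a).mul (monic_X_pow k)
  have hed : ∀ k, (e k).natDegree = k := by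
    rintro (_ | k)
    · exact natDegree_one
    · change ((X + C a) * X ^ k).natDegree = k + 1
      rw [(monic_X_add_C a).natDegree_mul (monic_X_pow k), natDegree_X_add_C, natDegree_X_pow]
      ring
  have h := (det_linearMap_monic l b hm hd).trans (det_linearMap_monic l e hem hed).symm
  rw [det_eq_of_first_row (of fun i j => l i (e j)) (by simp [l, e, leval])
    (by intro j; simp [l, e, leval])] at h
  have hs : ((of fun i j : Fin (n + 1) => l i (e j)).submatrix Fin.succ Fin.succ) =
      of fun i j : Fin n => aeval (u i) ((X + C a) * X ^ (j : ℕ)) := by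
    ext i j
    simp [l, e]
  rw [hs, det_row_mul_vandermonde] at h
  rw [← h, det_succ_row_zero, Finset.sum_range]
  refine Finset.sum_congr rfl fun k _ => ?_
  rw [Algebra.smul_def, map_mul, map_pow, map_neg, map_one]
  congr 1
  unfold polyDet
  congr 1
  ext i j
  simp [l, succAbove_val]

/-- The sum over ordered pairs of distinct indices in a double Laplace expansion, regrouped by
unordered pairs. -/
theorem sum_skip_pairs {M : Type*} [AddCommMonoid M] (n : ℕ) (g : ℕ → ℕ → M) :
    ∑ k ∈ Finset.range (n + 2), ∑ l ∈ Finset.range (n + 1), g k (skip k l) =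
      ∑ p ∈ Finset.range (n + 1), ∑ q ∈ Finset.range (n - p + 1),
        (g (n - p - q) (n - p + 1) + g (n - p + 1) (n - p - q)) := by
  have h1 : ∀ k ∈ Finset.range (n + 2), ∑ l ∈ Finset.range (n + 1), g k (skip k l) =
      ∑ l ∈ Finset.range k, g k l + ∑ l ∈ Finset.Ico (k + 1) (n + 2), g k l := by
    intro k hk
    have hk' : k ≤ n + 1 := by simpa [Nat.lt_succ_iff] using hk
    rw [← Finset.sum_range_add_sum_Ico _ hk', ← Finset.sum_Ico_add' _ k (n + 1) 1]
    congr 1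
    · refine Finset.sum_congr rfl fun l hl => ?_
      rw [skip, if_pos (Finset.mem_range.1 hl)]
    · refine Finset.sum_congr rfl fun l hl => ?_
      rw [skip, if_neg (Finset.mem_Ico.1 hl).1.not_gt]
  rw [Finset.sum_congr rfl h1, Finset.sum_add_distrib]
  -- Exchanging summation indexes the pairs k < l by their larger member, which becomes n - p + 1.
  have h2 : ∑ k ∈ Finset.range (n + 2), ∑ l ∈ Finset.Ico (k + 1) (n + 2), g k l =
      ∑ l ∈ Finset.range (n + 2), ∑ k ∈ Finset.range l, g k l := by
    refine Finset.sum_comm' fun k l => ?_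
    simp only [Finset.mem_range, Finset.mem_Ico]
    omega
  rw [h2, ← Finset.sum_add_distrib, Finset.sum_range_succ']
  simp only [Finset.range_zero, Finset.sum_empty, add_zero, ← Finset.sum_add_distrib]
  rw [← Finset.sum_range_reflect]
  refine Finset.sum_congr rfl fun p hp => ?_
  have hp' : p ≤ n := by simpa [Nat.lt_succ_iff] using hp
  have e : n + 1 - 1 - p + 1 = n - p + 1 := by omega
  rw [e, ← Finset.sum_range_reflect]
  refine Finset.sum_congr rfl fun q _ => ?_
  rw [add_comm, Nat.add_sub_cancel]

/-- The coefficients of the expansion of `∏ P(u_i)` for a monic quadratic polynomial `P`. -/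
noncomputable def quadCoeff (b : ℕ → K[X]) (P : K[X]) (q r : ℕ) : K :=
  (-1) ^ (q + 1) * ((b (r + q + 1) %ₘ P).coeff 0 * (b r %ₘ P).coeff 1 -
    (b r %ₘ P).coeff 0 * (b (r + q + 1) %ₘ P).coeff 1)

/-- The two extra rows are the coefficients of the remainder modulo P, replacing evaluation at the
roots, which may be missing from K or coincide. They read 1 and X as the identity block and kill P
X^k; in the basis `b`, their 2×2 minors are the coefficients `quadCoeff`. -/
theorem prod_mul_vandermonde_quadratic {R : Type*} [CommRing R] [Algebra K R] {n : ℕ}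
    (b : ℕ → K[X]) (hm : ∀ k, (b k).Monic) (hd : ∀ k, (b k).natDegree = k) (u : Fin n → R)
    (P : K[X]) (hP : P.Monic) (hP2 : P.natDegree = 2) :
    (∏ i, aeval (u i) P) * det (vandermonde u) =
      ∑ p ∈ Finset.range (n + 1), ∑ q ∈ Finset.range (n - p + 1),
        quadCoeff b P q (n - p - q) •
          polyDet b u (fun j => skip (n - p + 1) (skip (n - p - q) j)) := by
  let l : Fin (n + 2) → K[X] →ₗ[K] R := Fin.cons
    ((Algebra.linearMap K R).comp ((lcoeff K 0).comp (modByMonicHom P))) (Fin.cons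
    ((Algebra.linearMap K R).comp ((lcoeff K 1).comp (modByMonicHom P)))
    (fun i => (aeval (u i) : K[X] →ₐ[K] R).toLinearMap))
  let e : ℕ → K[X] := fun k => match k with
    | 0 => 1
    | 1 => X
    | k + 2 => P * X ^ k
  have hem : ∀ k, (e k).Monic := by
    rintro (_ | _ | k)
    · exact monic_one
    · exact monic_X
    · exact hP.mul (monic_X_pow k)
  have hed : ∀ k, (e k).natDegree = k := by
    rintro (_ | _ | k)
    · exact natDegree_one
    · exact natDegree_X
    · change (P * X ^ k).natDegree = k + 2
      rw [hP.natDegree_mul (monic_X_pow k), hP2, natDegree_X_pow]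
      ring
  have h1 : (1 : K[X]) %ₘ P = 1 := by
    rw [modByMonic_eq_self_iff hP]
    exact degree_lt_degree (by rw [natDegree_one, hP2]; norm_num)
  have hX : (X : K[X]) %ₘ P = X := by
    rw [modByMonic_eq_self_iff hP]
    exact degree_lt_degree (by rw [natDegree_X, hP2]; norm_num)
  have hk : ∀ k, (P * X ^ k) %ₘ P = 0 := fun k => by
    rw [modByMonic_eq_zero_iff_dvd hP]; exact dvd_mul_right _ _
  have h := (det_linearMap_monic l b hm hd).trans (det_linearMap_monic l e hem hed).symm
  rw [det_eq_of_first_row (of fun i j => l i (e j)) (by simp [l, e, modByMonicHom, h1])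
      (by
        intro j
        refine Fin.cases ?_ (fun j => ?_) j
        · simp [l, e, modByMonicHom, hX]
        · simp [l, e, modByMonicHom, hk]),
    det_eq_of_first_row ((of fun i j : Fin (n + 2) => l i (e j)).submatrix Fin.succ Fin.succ)
      (by simp [l, e, modByMonicHom, hX])
      (by
        intro j
        simp [l, e, modByMonicHom, hk])] at h
  have hs : (((of fun i j : Fin (n + 2) => l i (e j)).submatrix Fin.succ Fin.succ).submatrix
      Fin.succ Fin.succ) = of fun i j : Fin n => aeval (u i) (P * X ^ (j : ℕ)) := by
    ext i j
    simp [l, e]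
  rw [hs, det_row_mul_vandermonde] at h
  let c : ℕ → ℕ → K := fun i k => (b k %ₘ P).coeff i
  let D : ℕ → ℕ → R := fun k m => polyDet b u (fun j => skip k (skip m j))
  -- Here m is the column in the full matrix. If m > k, its position after removing column k is m -
  -- 1, whence the extra minus sign.
  let g : ℕ → ℕ → R := fun k m =>
    if m < k then ((-1) ^ (k + m) * (c 0 k * c 1 m)) • D k m
    else (-((-1) ^ (k + m) * (c 0 k * c 1 m))) • D m k
  -- The same two columns are deleted in either order, with the index renumbered.
  have hD : ∀ k m, k ≤ m → D k m = D (m + 1) k := by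
    intro k m hkm
    simp only [D]
    congr 1
    ext j
    simp only [skip]
    split_ifs <;> omega
  have hexp : (of fun i j : Fin (n + 2) => l i (b j)).det =
      ∑ k ∈ Finset.range (n + 2), ∑ m ∈ Finset.range (n + 1), g k (skip k m) := by
    rw [det_succ_row_zero, Finset.sum_range]
    refine Finset.sum_congr rfl fun k _ => ?_
    rw [det_succ_row_zero, Finset.mul_sum, Finset.sum_range]
    refine Finset.sum_congr rfl fun m _ => ?_
    have hdet : ((((of fun i j : Fin (n + 2) => l i (b j)).submatrix Fin.succ k.succAbove)).submatrix
        Fin.succ m.succAbove).det = D k m := by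
      simp only [D, polyDet]
      congr 1
      ext i j
      simp [l, succAbove_val]
    have e0 : (of fun i j : Fin (n + 2) => l i (b j)) 0 k = algebraMap K R (c 0 k) := by
      simp [l, c, modByMonicHom]
    have e1 : ((of fun i j : Fin (n + 2) => l i (b j)).submatrix Fin.succ k.succAbove) 0 m =
        algebraMap K R (c 1 (skip k m)) := by
      simp [l, c, modByMonicHom, succAbove_val]
    rw [hdet, e0, e1]
    by_cases hmk : (m : ℕ) < k
    · have hsk : skip k m = m := by simp [skip, hmk]
      simp only [g, hsk, if_pos hmk, Algebra.smul_def, map_mul, map_pow, map_neg, map_one]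
      ring
    · have hsk : skip k m = m + 1 := by simp [skip, hmk]
      have : ¬ ((m : ℕ) + 1 < k) := by omega
      simp only [g, hsk, if_neg this, Algebra.smul_def, map_mul, map_pow, map_neg, map_one,
        ← hD k m (by omega)]
      ring
  rw [← h, hexp, sum_skip_pairs]
  refine Finset.sum_congr rfl fun p hp => Finset.sum_congr rfl fun q hq => ?_
  have hq' : q ≤ n - p := by simpa [Nat.lt_succ_iff] using hq
  obtain ⟨r, hr⟩ := Nat.exists_eq_add_of_le hq'
  have e1 : n - p - q = r := by omega
  have e2 : n - p + 1 = r + q + 1 := by omega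
  rw [e1, e2]
  have i1 : ¬ (r + q + 1 < r) := by omega
  have i2 : r < r + q + 1 := by omega
  simp only [g, if_neg i1, if_pos i2, ← add_smul]
  congr 1
  have s1 : (-1 : K) ^ (r + (r + q + 1)) = (-1) ^ (q + 1) := by
    rw [← add_assoc, ← add_assoc, add_assoc, pow_add, ← two_mul, pow_mul]
    simp
  rw [add_comm (r + q + 1) r, s1]
  simp only [quadCoeff, c]
  ring

/-- Substituting -X commutes with division with remainder. Each minor acquires (-1)^(r+q+1) and
(-1)^r from the two polynomials and -1 from the linear coefficient, in total (-1)^q. -/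
theorem quadCoeff_chebFamily_neg (ε : K) (P : K[X]) (hP : P.Monic) (hP2 : P.natDegree = 2)
    (q r : ℕ) :
    quadCoeff (chebFamily (-ε)) (P.comp (-X)) q r = (-1) ^ q * quadCoeff (chebFamily ε) P q r := by
  have hQ : (P.comp (-X)).Monic := by
    rw [Monic, comp_neg_X_leadingCoeff_eq, hP.leadingCoeff, hP2]
    norm_num
  have hmod : ∀ k, chebFamily (-ε) k %ₘ P.comp (-X) =
      (-1) ^ k * (chebFamily ε k %ₘ P).comp (-X) := by
    intro k
    refine (div_modByMonic_unique ((-1) ^ k * (chebFamily ε k /ₘ P).comp (-X)) _ hQ ⟨?_, ?_⟩).2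
    · rw [chebFamily_neg]
      conv_rhs => rw [← modByMonic_add_div (chebFamily ε k) P]
      simp only [add_comp, mul_comp]
      ring
    · rw [degree_comp_neg_X, degree_mul, degree_comp_neg_X]
      have h1 : ((-1) ^ k : K[X]).degree = 0 := by
        rw [show ((-1) ^ k : K[X]) = C ((-1) ^ k) by simp]
        exact degree_C (pow_ne_zero _ (neg_ne_zero.2 one_ne_zero))
      rw [h1, zero_add]
      exact degree_modByMonic_lt _ hP
  have hc : ∀ k i, (chebFamily (-ε) k %ₘ P.comp (-X)).coeff i =
      (-1) ^ k * ((-1) ^ i * (chebFamily ε k %ₘ P).coeff i) := by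
    intro k i
    have h1 : ((-1) ^ k : K[X]) = C ((-1) ^ k) := by simp
    have h2 : (-X : K[X]) = C (-1) * X := by simp
    rw [hmod, h1, coeff_C_mul, h2, comp_C_mul_X_coeff, mul_comm ((-1) ^ i)]
  simp only [quadCoeff, hc]
  have h1 : ((-1 : K) ^ r) * (-1) ^ r = 1 := by rw [← mul_pow]; simp
  rw [pow_add, pow_add]
  linear_combination ((-1) ^ q * (-1) ^ 1 * (-1) ^ q * ((chebFamily ε (r + q + 1) %ₘ P).coeff 0 * (chebFamily ε r %ₘ P).coeff 1 -
    (chebFamily ε r %ₘ P).coeff 0 * (chebFamily ε (r + q + 1) %ₘ P).coeff 1)) * h1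

end Polynomials

/-! ### Alternants as determinants -/

section Alternants

open Matrix

variable {K : Type*} [Field K] {n : ℕ}

theorem xMonomial_add (κ μ : Fin n → ℚ) :
    xMonomial K (κ + μ) = xMonomial K κ * xMonomial K μ := by
  simp only [xMonomial]
  rw [← map_mul, AddMonoidAlgebra.single_mul_single, one_mul]

theorem xMonomial_zero : xMonomial K (0 : Fin n → ℚ) = 1 := by
  simp only [xMonomial]
  rw [← AddMonoidAlgebra.one_def, map_one]

theorem xMonomial_eq_prod (κ : Fin n → ℚ) :
    xMonomial K κ = ∏ i, xMonomial K (Pi.single i (κ i)) := by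
  have h : ∀ s : Finset (Fin n), xMonomial K (∑ i ∈ s, Pi.single i (κ i)) =
      ∏ i ∈ s, xMonomial K (Pi.single i (κ i)) := by
    intro s
    induction s using Finset.induction_on with
    | empty => simp [xMonomial_zero]
    | insert a s ha ih => rw [Finset.sum_insert ha, Finset.prod_insert ha, xMonomial_add, ih]
  rw [← h, Finset.univ_sum_single]

/-- The sum of the monomials `x^{w(κ)}` over all signed permutations `w = (σ, ε)`, with the
coefficients `sgn(σ) ∏ⱼ χⱼ(ε_{σ(j)})`. -/
noncomputable def signedSum (χ : Fin n → ℤˣ → K) (κ : Fin n → ℚ) : CharField K n :=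
  ∑ w : SignedPerm n,
    ((((Equiv.Perm.sign w.1 : ℤˣ) : ℤ) : K) * ∏ i, χ (w.1.symm i) (w.2 i)) • xMonomial K (w.act κ)

/-- The Leibniz formula, with each product of two-term entries multiplied out over the sign choices.
-/
theorem signedSum_eq_det (χ : Fin n → ℤˣ → K) (κ : Fin n → ℚ) :
    signedSum χ κ = det (of fun i j => χ j 1 • xMonomial K (Pi.single i (κ j)) +
      χ j (-1) • xMonomial K (Pi.single i (-κ j))) := by
  have hM : ∀ i j : Fin n, χ j 1 • xMonomial K (Pi.single i (κ j)) +
      χ j (-1) • xMonomial K (Pi.single i (-κ j)) =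
      ∑ e : ℤˣ, χ j e • xMonomial K (Pi.single i (((e : ℤ) : ℚ) * κ j)) := by
    intro i j
    rw [UnitsInt.univ, Finset.sum_pair (by decide)]
    simp
  rw [det_apply', signedSum, Fintype.sum_prod_type]
  refine Finset.sum_congr rfl fun σ _ => ?_
  rw [← Equiv.prod_comp σ.symm]
  simp only [of_apply, Equiv.apply_symm_apply, hM]
  rw [Finset.prod_univ_sum, Finset.mul_sum, Fintype.piFinset_univ]
  refine Finset.sum_congr rfl fun ε _ => ?_
  rw [xMonomial_eq_prod]
  simp only [Algebra.smul_def, map_mul, map_prod, Finset.prod_mul_distrib, SignedPerm.act,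
    map_intCast, mul_assoc]

theorem alternant_eq_signedSum (G : ClassicalFamily) (hG : weylGroup G n = Finset.univ)
    (κ : Fin n → ℚ) :
    alternant K G κ = signedSum (fun _ e => ((e : ℤ) : K)) κ := by
  rw [alternant, hG, signedSum]
  refine Finset.sum_congr rfl fun w _ => ?_
  rw [← Int.cast_smul_eq_zsmul K]
  simp [SignedPerm.sgn, Units.coe_prod]

theorem alternant_soEven (κ : Fin n → ℚ) :
    alternant K .soEven κ = ∑ w : SignedPerm n with ∏ i, w.2 i = 1,
      (((Equiv.Perm.sign w.1 : ℤˣ) : ℤ) : K) • xMonomial K (w.act κ) := by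
  rw [alternant, weylGroup]
  refine Finset.sum_congr rfl fun w hw => ?_
  rw [← Int.cast_smul_eq_zsmul K, SignedPerm.sgn, (Finset.mem_filter.1 hw).2, mul_one]

theorem negLast_apply (κ : Fin (n + 1) → ℚ) (i : Fin (n + 1)) :
    negLast κ i = if i = Fin.last n then -κ i else κ i := by
  simp [negLast, Fin.ext_iff]

/-- Negating the last component before acting amounts to flipping one sign of w, which exchanges
even and odd sign changes; the two alternants thus cover all signed permutations. -/
theorem alternant_soEven_add_negLast (κ : Fin (n + 1) → ℚ) :
    alternant K .soEven κ + alternant K .soEven (negLast κ) = signedSum (fun _ _ => (1 : K)) κ := by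
  simp only [signedSum, Finset.prod_const_one, mul_one]
  rw [← Finset.sum_filter_add_sum_filter_not Finset.univ
    (fun w : SignedPerm (n + 1) => ∏ i, w.2 i = 1), alternant_soEven, alternant_soEven]
  congr 1
  let f : SignedPerm (n + 1) → SignedPerm (n + 1) := fun w =>
    (w.1, w.2 * Pi.mulSingle (w.1 (Fin.last n)) (-1))
  have hf : ∀ w, f (f w) = w := by
    intro w
    simp only [f, mul_assoc, ← Pi.mulSingle_mul]
    simp
  have hp : ∀ w, ∏ i, (f w).2 i = - ∏ i, w.2 i := by
    intro w
    simp [f, Finset.prod_mul_distrib, Finset.prod_pi_mulSingle']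
  refine Finset.sum_nbij' f f ?_ ?_ (fun w _ => hf w) (fun w _ => hf w) ?_
  · intro w hw
    simp only [Finset.mem_filter, Finset.mem_univ, true_and] at hw ⊢
    rw [hp, hw]
    decide
  · intro w hw
    simp only [Finset.mem_filter, Finset.mem_univ, true_and] at hw ⊢
    rw [hp, (Int.units_eq_one_or _).resolve_left hw]
    decide
  · intro w _
    have : w.act (negLast κ) = (f w).act κ := by
      ext i
      simp only [SignedPerm.act, negLast_apply, f, Pi.mul_apply, Pi.mulSingle_apply,
        Equiv.symm_apply_eq]
      split_ifs <;> simp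
    rw [this]

/-- The sign attached to a zero component does not affect the monomial, so the parity condition can
be traded for the condition that this sign be trivial. This again makes the sum a determinant. -/
theorem alternant_soEven_of_last_eq_zero (κ : Fin (n + 1) → ℚ) (hκ : κ (Fin.last n) = 0) :
    alternant K .soEven κ =
      signedSum (fun j e => if j = Fin.last n ∧ e ≠ 1 then (0 : K) else 1) κ := by
  have hs : signedSum (fun j e => if j = Fin.last n ∧ e ≠ 1 then (0 : K) else 1) κ =
      ∑ w : SignedPerm (n + 1) with w.2 (w.1 (Fin.last n)) = 1,
        (((Equiv.Perm.sign w.1 : ℤˣ) : ℤ) : K) • xMonomial K (w.act κ) := by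
    rw [signedSum, Finset.sum_filter]
    refine Finset.sum_congr rfl fun w _ => ?_
    split_ifs with h
    · rw [Finset.prod_eq_one, mul_one]
      intro i _
      rw [if_neg]
      rintro ⟨h1, h2⟩
      rw [Equiv.symm_apply_eq] at h1
      exact h2 (h1 ▸ h)
    · rw [Finset.prod_eq_zero (Finset.mem_univ (w.1 (Fin.last n))), mul_zero, zero_smul]
      simp [h]
  rw [hs, alternant_soEven]
  let s : SignedPerm (n + 1) → ℤˣ → SignedPerm (n + 1) := fun w e =>
    (w.1, Function.update w.2 (w.1 (Fin.last n)) e)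
  have hp : ∀ w e, (∏ i, (s w e).2 i) * w.2 (w.1 (Fin.last n)) = e * ∏ i, w.2 i := by
    intro w e
    simp only [s]
    rw [Finset.prod_update_of_mem (Finset.mem_univ _), mul_assoc, mul_comm (∏ i ∈ _, _),
      ← Finset.erase_eq, Finset.mul_prod_erase Finset.univ w.2 (Finset.mem_univ _)]
  -- Under the parity condition, the erased sign is recovered as the product of the remaining ones.
  refine Finset.sum_nbij' (fun w => s w 1) (fun w => s w (∏ i, w.2 i)) ?_ ?_ ?_ ?_ ?_
  · intro w _
    simp [s]
  · intro w hw
    simp only [Finset.mem_filter, Finset.mem_univ, true_and] at hw ⊢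
    have := hp w (∏ i, w.2 i)
    rw [hw, mul_one] at this
    rw [this, ← pow_two, Int.units_sq]
  · intro w hw
    simp only [Finset.mem_filter, Finset.mem_univ, true_and] at hw
    have := hp w 1
    rw [hw, mul_one] at this
    have h2 : ∏ i, (s w 1).2 i = w.2 (w.1 (Fin.last n)) := by
      rw [eq_inv_of_mul_eq_one_left this, Int.units_inv_eq_self]
    change s (s w 1) (∏ i, (s w 1).2 i) = w
    rw [h2]
    simp [s]
  · intro w hw
    simp only [Finset.mem_filter, Finset.mem_univ, true_and] at hw
    simp only [s, Function.update_idem]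
    rw [← hw, Function.update_eq_self]
  · intro w _
    have : (s w 1).act κ = w.act κ := by
      ext i
      simp only [SignedPerm.act, s]
      by_cases hi : i = w.1 (Fin.last n)
      · simp [hi, hκ]
      · rw [Function.update_of_ne hi]
    rw [this]

/-! ### Linear independence of signed sums -/

/-- A signed permutation that maps a strictly dominant weight with positive components to another
such weight is trivial. -/
theorem SignedPerm.act_eq_iff_of_strictAnti (w : SignedPerm n) {κ μ : Fin n → ℚ}
    (hκ : StrictAnti κ) (hκ₀ : ∀ i, 0 < κ i) (hμ : StrictAnti μ) (hμ₀ : ∀ i, 0 < μ i) :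
    w.act κ = μ ↔ w = 1 ∧ κ = μ := by
  constructor
  · intro h
    have hε : w.2 = 1 := by
      ext i
      rcases Int.units_eq_one_or (w.2 i) with h1 | h1
      · simp [h1]
      · have h2 := congrFun h i
        simp only [SignedPerm.act, h1] at h2
        have := hκ₀ (w.1.symm i)
        have := hμ₀ i
        push_cast at h2
        linarith
    have h2 : ∀ i, κ (w.1.symm i) = μ i := by
      intro i
      have := congrFun h i
      simpa [SignedPerm.act, hε] using this
    have hm : StrictMono (w.1.symm) := by
      intro i j hij
      have := hμ hij
      rw [← h2, ← h2] at this
      exact hκ.lt_iff_gt.1 this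
    -- The only order automorphism of `Fin n` is the identity.
    have hσ : w.1.symm = 1 := by
      ext i
      have := congrArg (fun f : Fin n ≃o Fin n => ((f i : Fin n) : ℕ)) (Subsingleton.elim
        (hm.orderIsoOfSurjective _ w.1.symm.surjective) (OrderIso.refl _))
      simpa using this
    have h3 : w.1 = 1 := by
      rw [← Equiv.symm_symm w.1, hσ]; rfl
    refine ⟨Prod.ext h3 hε, ?_⟩
    ext i
    rw [← h2, hσ]
    rfl
  · rintro ⟨rfl, rfl⟩
    ext i
    simp only [SignedPerm.act, Prod.snd_one, Prod.fst_one, Pi.one_apply, Units.val_one,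
      Int.cast_one, one_mul]
    rfl

theorem algebraMap_smul_charField (c : K) (f : AddMonoidAlgebra K (Fin n → ℚ)) :
    algebraMap (AddMonoidAlgebra K (Fin n → ℚ)) (CharField K n) (c • f) =
      c • algebraMap (AddMonoidAlgebra K (Fin n → ℚ)) (CharField K n) f :=
  map_smul (IsScalarTower.toAlgHom K (AddMonoidAlgebra K (Fin n → ℚ)) (CharField K n)) c f

/-- The alternating sum `signedSum` in the group algebra. -/
noncomputable def signedSumAlg (χ : Fin n → ℤˣ → K) (κ : Fin n → ℚ) :
    AddMonoidAlgebra K (Fin n → ℚ) :=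
  ∑ w : SignedPerm n, ((((Equiv.Perm.sign w.1 : ℤˣ) : ℤ) : K) * ∏ i, χ (w.1.symm i) (w.2 i)) •
    AddMonoidAlgebra.single (w.act κ) (1 : K)

theorem algebraMap_signedSumAlg (χ : Fin n → ℤˣ → K) (κ : Fin n → ℚ) :
    algebraMap (AddMonoidAlgebra K (Fin n → ℚ)) (CharField K n) (signedSumAlg χ κ) =
      signedSum χ κ := by
  simp only [signedSumAlg, signedSum, map_sum, algebraMap_smul_charField, xMonomial]

theorem coeff_signedSumAlg (χ : Fin n → ℤˣ → K) (hχ : ∀ j, χ j 1 = 1) {κ μ : Fin n → ℚ}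
    (hκ : StrictAnti κ) (hκ₀ : ∀ i, 0 < κ i) (hμ : StrictAnti μ) (hμ₀ : ∀ i, 0 < μ i) :
    (signedSumAlg χ κ).coeff μ = if κ = μ then 1 else 0 := by
  simp only [signedSumAlg, AddMonoidAlgebra.coeff_sum, AddMonoidAlgebra.coeff_smul,
    AddMonoidAlgebra.coeff_single, Finsupp.finsetSum_apply, Finsupp.smul_apply,
    Finsupp.single_apply, SignedPerm.act_eq_iff_of_strictAnti _ hκ hκ₀ hμ hμ₀]
  rw [Finset.sum_eq_single 1]
  · simp [hχ]
  · intro w _ hw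
    simp [hw]
  · simp

/-- Signed sums of distinct strictly dominant weights are linearly independent. -/
theorem coeff_eq_of_sum_signedSum_eq (χ : Fin n → ℤˣ → K) (hχ : ∀ j, χ j 1 = 1) {T : Type*}
    (S : Finset T) (κ : T → Fin n → ℚ) (hκ : ∀ t ∈ S, StrictAnti (κ t))
    (hκ₀ : ∀ t ∈ S, ∀ i, 0 < κ t i) (hinj : Set.InjOn κ S) (c c' : T → K)
    (h : ∑ t ∈ S, c t • signedSum χ (κ t) = ∑ t ∈ S, c' t • signedSum χ (κ t)) :
    ∀ t ∈ S, c t = c' t := by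
  intro t ht
  have key : ∀ d : T → K, (∑ s ∈ S, d s • signedSumAlg χ (κ s)).coeff (κ t) = d t := by
    intro d
    simp only [AddMonoidAlgebra.coeff_sum, AddMonoidAlgebra.coeff_smul, Finsupp.finsetSum_apply,
      Finsupp.smul_apply]
    rw [Finset.sum_eq_single t]
    · rw [coeff_signedSumAlg χ hχ (hκ t ht) (hκ₀ t ht) (hκ t ht) (hκ₀ t ht), if_pos rfl]
      simp
    · intro s hs hst
      rw [coeff_signedSumAlg χ hχ (hκ s hs) (hκ₀ s hs) (hκ t ht) (hκ₀ t ht),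
        if_neg fun e => hst (hinj hs ht e), smul_zero]
    · exact fun h => absurd ht h
  rw [← key c, ← key c']
  congr 2
  -- Coefficients exist only in the group algebra, so the identity is pulled back there.
  apply IsFractionRing.injective (AddMonoidAlgebra K (Fin n → ℚ)) (CharField K n)
  simpa only [map_sum, algebraMap_smul_charField, algebraMap_signedSumAlg] using h

theorem signedSum_ne_zero (χ : Fin n → ℤˣ → K) (hχ : ∀ j, χ j 1 = 1) {κ : Fin n → ℚ}
    (hκ : StrictAnti κ) (hκ₀ : ∀ i, 0 < κ i) : signedSum χ κ ≠ 0 := by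
  intro h
  have := coeff_eq_of_sum_signedSum_eq χ hχ {()} (fun _ => κ) (fun _ _ => hκ) (fun _ _ => hκ₀)
    (by simp) (fun _ => 1) (fun _ => 0) (by simp [h]) () (by simp)
  exact one_ne_zero this

end Alternants

/-! ### Expansions with cleared denominators -/

section Expansions

open Matrix

variable {K : Type*} [Field K] {n : ℕ}

/-- The weight with components `λ_i + n - i + h - 1`, for `i = 1, …, n`. -/
def shiftedWeight (h : ℚ) (wt : Fin n → ℚ) : Fin n → ℚ := fun i => wt i + ((n : ℚ) - 1 - (i : ℕ)) + h

/-- The coefficients `1` and `η` of `1` and `-1`. -/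
def signCoeff (K : Type*) [Field K] (n : ℕ) (η : K) : Fin n → ℤˣ → K :=
  fun _ e => if e = 1 then 1 else η

theorem signCoeff_one : signCoeff K n 1 = fun _ _ => 1 := by
  ext i e
  simp [signCoeff]

theorem signCoeff_neg_one : signCoeff K n (-1) = fun _ (e : ℤˣ) => ((e : ℤ) : K) := by
  ext i e
  rcases Int.units_eq_one_or e with rfl | rfl <;> simp [signCoeff]

/-- `x_i^k`. -/
noncomputable def xPow (K : Type*) [Field K] {n : ℕ} (i : Fin n) (k : ℚ) : CharField K n :=
  xMonomial K (Pi.single i k)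

theorem xPow_mul (i : Fin n) (k l : ℚ) : xPow K i k * xPow K i l = xPow K i (k + l) := by
  rw [xPow, xPow, xPow, ← xMonomial_add, Pi.single_add]

theorem xPow_zero (i : Fin n) : xPow K i 0 = 1 := by
  rw [xPow, Pi.single_zero, xMonomial_zero]

theorem xSym_eq (i : Fin n) (k : ℚ) : xSym K i k = xPow K i k + xPow K i (-k) := rfl

/-- `x_i^k + η x_i^{-k}`. -/
noncomputable def xTwist (i : Fin n) (η : K) (k : ℚ) : CharField K n :=
  xPow K i k + η • xPow K i (-k)

theorem xTwist_one (i : Fin n) (k : ℚ) : xTwist i (1 : K) k = xSym K i k := by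
  rw [xTwist, one_smul, xSym_eq]

theorem xSym_mul_xTwist (i : Fin n) (η : K) (k l : ℚ) :
    xSym K i l * xTwist i η k = xTwist i η (k + l) + xTwist i η (k - l) := by
  simp only [xSym_eq, xTwist, add_mul, mul_add, mul_smul_comm, xPow_mul, smul_add]
  rw [show l + k = k + l by ring, show l + -k = -(k - l) by ring, show -l + k = k - l by ring,
    show -l + -k = -(k + l) by ring]
  abel

/-- The condition `hε` extends the recurrence one step below h, and so says that the term at h + 1
is (u + ε) times the term at h. -/
theorem xTwist_eq_aeval (i : Fin n) (η ε : K) (h : ℚ)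
    (hε : xTwist i η (h - 1) + ε • xTwist i η h = 0) (k : ℕ) :
    Polynomial.aeval (xSym K i 1) (chebFamily ε k) * xTwist i η h = xTwist i η (k + h) := by
  have key := aeval_chebFamily_mul ε (xSym K i 1) (fun k => xTwist i η (k + h)) ?_ ?_ k
  · simpa using key
  · have := xSym_mul_xTwist i η h 1
    simp only [Nat.cast_one, Nat.cast_zero, zero_add, add_mul, this]
    rw [Algebra.smul_def] at hε
    rw [add_comm 1 h]
    linear_combination -hε
  · intro k
    have := xSym_mul_xTwist i η (k + 1 + h) 1
    push_cast
    rw [this, show (k : ℚ) + 1 + h + 1 = k + 2 + h by ring, show (k : ℚ) + 1 + h - 1 = k + h by ring]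
    ring

/-- For h = 1 and η = -1 the term at exponent 0 vanishes. In the next two cases h - 1 = -h, and the
antisymmetry or symmetry in the exponent gives ε = 1 or ε = -1. -/
theorem xTwist_boundary_sp (i : Fin n) :
    xTwist i (-1 : K) (1 - 1) + (0 : K) • xTwist i (-1) 1 = 0 := by
  simp [xTwist]

theorem xTwist_boundary_soOdd (i : Fin n) :
    xTwist i (-1 : K) (1 / 2 - 1) + (1 : K) • xTwist i (-1) (1 / 2) = 0 := by
  norm_num [xTwist]

theorem xTwist_boundary_spin (i : Fin n) :
    xTwist i (1 : K) (1 / 2 - 1) + (-1 : K) • xTwist i 1 (1 / 2) = 0 := by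
  norm_num [xTwist]

theorem signedSum_eq_polyDet (η ε : K) (h : ℚ)
    (hε : ∀ i : Fin n, xTwist i η (h - 1) + ε • xTwist i η h = 0) (m : Fin n → ℕ) (κ : Fin n → ℚ)
    (hκ : ∀ j, κ j = m j + h) :
    signedSum (signCoeff K n η) κ =
      (∏ i, xTwist i η h) * polyDet (chebFamily ε) (fun i => xSym K i 1) m := by
  rw [signedSum_eq_det, polyDet, ← det_mul_column]
  congr 1
  ext i j
  simp only [of_apply]
  rw [mul_comm, xTwist_eq_aeval i η ε h (hε i), hκ]
  have : (-1 : ℤˣ) ≠ 1 := by decide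
  simp [signCoeff, xTwist, xPow, this]

theorem polyDet_comp_rev {R : Type*} [CommRing R] [Algebra K R] (b : ℕ → Polynomial K)
    (u : Fin n → R) (m : ℕ → ℕ) :
    polyDet b u (fun j => m (Fin.rev j)) =
      ((Equiv.Perm.sign (Fin.revPerm : Equiv.Perm (Fin n)) : ℤ) : R) *
        polyDet b u (fun j => m j) := by
  rw [polyDet, polyDet, ← det_permute']
  rfl

/-- The expansion of `∏ (a + x_i + x_i⁻¹)`, multiplied by the denominator of the characters. -/
def LinearExpansion (n : ℕ) (h : ℚ) (η a : K) (φ : ℕ → K) : Prop :=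
  (∏ i : Fin n, (a • 1 + xSym K i 1)) * signedSum (signCoeff K n η) (shiftedWeight h 0) =
    ∑ q ∈ Finset.range (n + 1),
      φ (n - q) • signedSum (signCoeff K n η) (shiftedWeight h (boxWeight n 0 q))

/-- The expansion of `∏ (a + b (x_i + x_i⁻¹) + x_i² + x_i⁻²)`, multiplied by the denominator of the
characters. -/
def QuadraticExpansion (n : ℕ) (h : ℚ) (η a b : K) (ψ : ℕ → ℕ → K) : Prop :=
  (∏ i : Fin n, (a • 1 + b • xSym K i 1 + xSym K i 2)) *
      signedSum (signCoeff K n η) (shiftedWeight h 0) =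
    ∑ p ∈ Finset.range (n + 1), ∑ q ∈ Finset.range (n - p + 1),
      ψ q (n - p - q) • signedSum (signCoeff K n η) (shiftedWeight h (boxWeight n p q))

/-- Explicit coefficients of the linear expansion. -/
noncomputable def linearCoeff (ε a : K) (r : ℕ) : K :=
  (-1) ^ r * (chebFamily ε r).eval (-a)

open Polynomial in
/-- `X² + b X + a - 2`, whose value at `x + x⁻¹` is `a + b (x + x⁻¹) + x² + x⁻²`. -/
noncomputable def quadPoly (a b : K) : K[X] := X ^ 2 + C b * X + C (a - 2)

theorem quadPoly_monic (a b : K) : (quadPoly a b).Monic := by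
  unfold quadPoly; monicity!

theorem quadPoly_natDegree (a b : K) : (quadPoly a b).natDegree = 2 := by
  unfold quadPoly; compute_degree!

theorem quadPoly_comp_neg (a b : K) :
    (quadPoly a b).comp (-Polynomial.X) = quadPoly a (-b) := by
  simp [quadPoly]

theorem xSym_one_sq (i : Fin n) : xSym K i 1 ^ 2 = xSym K i 2 + 2 := by
  have := xSym_mul_xTwist i (1 : K) 1 1
  rw [xTwist_one, xTwist_one, xTwist_one] at this
  rw [pow_two, this, sub_self, xSym_eq i 0, neg_zero, xPow_zero]
  norm_num

/-- Explicit coefficients of the quadratic expansion. -/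
noncomputable def quadraticCoeff (ε a b : K) (q r : ℕ) : K :=
  quadCoeff (chebFamily ε) (quadPoly a b) q r

/-- Less h and read in increasing order, the exponents are 0, …, n + 1 without n - p - q and n - p +
1: the jumps by one where the weight goes from 0 to 1 and from 1 to 2. The sign comes from reversing
the columns. -/
theorem signedSum_shiftedWeight_box (η ε : K) (h : ℚ)
    (hε : ∀ i : Fin n, xTwist i η (h - 1) + ε • xTwist i η h = 0) (p q : ℕ) (hpq : p + q ≤ n) :
    signedSum (signCoeff K n η) (shiftedWeight h (boxWeight n p q)) = (∏ i, xTwist i η h) *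
      (((Equiv.Perm.sign (Fin.revPerm : Equiv.Perm (Fin n)) : ℤ) : CharField K n) *
        polyDet (chebFamily ε) (fun i => xSym K i 1)
          (fun j => skip (n - p + 1) (skip (n - p - q) j))) := by
  rw [← polyDet_comp_rev _ _ (fun j => skip (n - p + 1) (skip (n - p - q) j))]
  refine signedSum_eq_polyDet η ε h hε _ _ fun j => ?_
  have hj := j.2
  simp only [shiftedWeight, boxWeight, Fin.val_rev, skip]
  have e : ((n - (j + 1) : ℕ) : ℚ) = n - 1 - (j : ℕ) := by
    rw [Nat.cast_sub (by omega)]; push_cast; ring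
  split_ifs <;> first | omega | (push_cast; rw [e]; ring)

theorem boxWeight_zero : boxWeight n 0 0 = 0 := by
  ext i; simp [boxWeight]

theorem signedSum_shiftedWeight_zero (η ε : K) (h : ℚ)
    (hε : ∀ i : Fin n, xTwist i η (h - 1) + ε • xTwist i η h = 0) :
    signedSum (signCoeff K n η) (shiftedWeight h 0) = (∏ i, xTwist i η h) *
      (((Equiv.Perm.sign (Fin.revPerm : Equiv.Perm (Fin n)) : ℤ) : CharField K n) *
        det (vandermonde fun i => xSym K i 1)) := by
  rw [← boxWeight_zero, signedSum_shiftedWeight_box η ε h hε 0 0 (Nat.zero_le _),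
    ← polyDet_val (chebFamily ε) (fun k => (chebFamily_monic_natDegree ε k).1)
      (fun k => (chebFamily_monic_natDegree ε k).2)]
  congr 3
  ext j
  have := j.2
  simp only [skip]
  split_ifs <;> omega

theorem linearExpansion_linearCoeff (η ε : K) (h : ℚ) (a : K)
    (hε : ∀ i : Fin n, xTwist i η (h - 1) + ε • xTwist i η h = 0) :
    LinearExpansion n h η a (linearCoeff ε a) := by
  have key := prod_mul_vandermonde_linear (chebFamily ε)
    (fun k => (chebFamily_monic_natDegree ε k).1) (fun k => (chebFamily_monic_natDegree ε k).2)
    (fun i : Fin n => xSym K i 1) a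
  rw [← Finset.sum_range_reflect] at key
  have hP : ∀ i : Fin n, Polynomial.aeval (xSym K i 1) (Polynomial.X + Polynomial.C a) =
      a • 1 + xSym K i 1 := by
    intro i
    simp [Algebra.smul_def, add_comm]
  simp only [hP] at key
  rw [LinearExpansion, signedSum_shiftedWeight_zero η ε h hε, mul_left_comm,
    mul_left_comm (∏ i : Fin n, (a • 1 + xSym K i 1)), key, Finset.mul_sum, Finset.mul_sum]
  refine Finset.sum_congr rfl fun q hq => ?_
  have hq' : q ≤ n := by simpa [Nat.lt_succ_iff] using hq
  rw [signedSum_shiftedWeight_box η ε h hε 0 q (by omega), mul_smul_comm, mul_smul_comm,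
    linearCoeff, show n + 1 - 1 - q = n - q by omega]
  -- For p = 0 the second omitted value n + 1 is never reached, so a single skip remains.
  congr 4
  ext j
  have := j.2
  simp only [skip]
  split_ifs <;> omega

theorem quadraticExpansion_quadraticCoeff (η ε : K) (h : ℚ) (a b : K)
    (hε : ∀ i : Fin n, xTwist i η (h - 1) + ε • xTwist i η h = 0) :
    QuadraticExpansion n h η a b (quadraticCoeff ε a b) := by
  have key := prod_mul_vandermonde_quadratic (chebFamily ε)
    (fun k => (chebFamily_monic_natDegree ε k).1) (fun k => (chebFamily_monic_natDegree ε k).2)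
    (fun i : Fin n => xSym K i 1) (quadPoly a b) (quadPoly_monic a b) (quadPoly_natDegree a b)
  have hP : ∀ i : Fin n, Polynomial.aeval (xSym K i 1) (quadPoly a b) =
      a • 1 + b • xSym K i 1 + xSym K i 2 := by
    intro i
    simp only [quadPoly, map_add, map_mul, map_pow, Polynomial.aeval_X, Polynomial.aeval_C,
      map_sub, xSym_one_sq, Algebra.smul_def, map_ofNat]
    ring
  simp only [hP] at key
  rw [QuadraticExpansion, signedSum_shiftedWeight_zero η ε h hε, mul_left_comm,
    mul_left_comm (∏ i : Fin n, (a • 1 + b • xSym K i 1 + xSym K i 2)), key, Finset.mul_sum,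
    Finset.mul_sum]
  refine Finset.sum_congr rfl fun p hp => ?_
  rw [Finset.mul_sum, Finset.mul_sum]
  refine Finset.sum_congr rfl fun q hq => ?_
  have hp' : p ≤ n := by simpa [Nat.lt_succ_iff] using hp
  have hq' : q ≤ n - p := by simpa [Nat.lt_succ_iff] using hq
  rw [signedSum_shiftedWeight_box η ε h hε p q (by omega), mul_smul_comm, mul_smul_comm,
    quadraticCoeff]

theorem boxWeight_antitone (p q : ℕ) : Antitone (boxWeight n p q) := by
  intro i j hij
  have : (i : ℕ) ≤ j := hij
  simp only [boxWeight]
  split_ifs <;> first | omega | norm_num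

theorem boxWeight_nonneg (p q : ℕ) (i : Fin n) : 0 ≤ boxWeight n p q i := by
  simp only [boxWeight]
  split_ifs <;> norm_num

theorem shiftedWeight_strictAnti (h : ℚ) {wt : Fin n → ℚ} (hw : Antitone wt) :
    StrictAnti (shiftedWeight h wt) := by
  intro i j hij
  have h1 := hw hij.le
  have h2 : ((i : ℕ) : ℚ) < (j : ℕ) := by exact_mod_cast hij
  simp only [shiftedWeight]
  linarith

theorem shiftedWeight_pos {h : ℚ} (hh : 0 < h) {wt : Fin n → ℚ} (hw : ∀ i, 0 ≤ wt i) (i : Fin n) :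
    0 < shiftedWeight h wt i := by
  have h1 := hw i
  have h2 : ((i : ℕ) : ℚ) + 1 ≤ n := by exact_mod_cast i.2
  simp only [shiftedWeight]
  linarith

theorem boxWeight_injective {p q p' q' : ℕ} (h : p + q ≤ n) (h' : p' + q' ≤ n)
    (e : boxWeight n p q = boxWeight n p' q') : p = p' ∧ q = q' := by
  have hp : ∀ p q p' q' : ℕ, p' + q' ≤ n → boxWeight n p q = boxWeight n p' q' → p' ≤ p := by
    intro p q p' q' h' e
    by_contra! hlt
    have := congrFun e ⟨p, by omega⟩
    simp only [boxWeight, lt_irrefl, if_false, if_pos hlt] at this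
    split_ifs at this <;> norm_num at this
  have hq : ∀ p q q' : ℕ, p + q' ≤ n → boxWeight n p q = boxWeight n p q' → q' ≤ q := by
    intro p q q' h' e
    by_contra! hlt
    have := congrFun e ⟨p + q, by omega⟩
    simp [boxWeight, hlt] at this
  have e1 : p = p' := le_antisymm (hp _ _ _ _ h e.symm) (hp _ _ _ _ h' e)
  subst e1
  exact ⟨rfl, le_antisymm (hq _ _ _ h e.symm) (hq _ _ _ h' e)⟩

theorem shiftedWeight_injective (h : ℚ) :
    Function.Injective (shiftedWeight h : (Fin n → ℚ) → Fin n → ℚ) := by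
  intro κ μ e
  ext i
  have := congrFun e i
  simp only [shiftedWeight] at this
  linarith

theorem LinearExpansion.unique {h : ℚ} (hh : 0 < h) {η a : K} {φ φ' : ℕ → K}
    (H : LinearExpansion n h η a φ) (H' : LinearExpansion n h η a φ') : ∀ r ≤ n, φ r = φ' r := by
  intro r hr
  have key := coeff_eq_of_sum_signedSum_eq (signCoeff K n η) (by simp [signCoeff])
    (Finset.range (n + 1)) (fun q => shiftedWeight h (boxWeight n 0 q))
    (fun q _ => shiftedWeight_strictAnti h (boxWeight_antitone 0 q))
    (fun q _ => shiftedWeight_pos hh (boxWeight_nonneg 0 q))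
    (fun q hq q' hq' e => by
      simp only [Finset.coe_range, Set.mem_Iio] at hq hq'
      exact (boxWeight_injective (by omega) (by omega) (shiftedWeight_injective h e)).2)
    _ _ (H.symm.trans H') (n - r) (by simp)
  simpa [Nat.sub_sub_self hr] using key

theorem QuadraticExpansion.unique {h : ℚ} (hh : 0 < h) {η a b : K} {ψ ψ' : ℕ → ℕ → K}
    (H : QuadraticExpansion n h η a b ψ) (H' : QuadraticExpansion n h η a b ψ') :
    ∀ q r : ℕ, q + r ≤ n → ψ q r = ψ' q r := by
  intro q r hqr
  rw [QuadraticExpansion, Finset.sum_sigma'] at H H'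
  have key := coeff_eq_of_sum_signedSum_eq (signCoeff K n η) (by simp [signCoeff])
    ((Finset.range (n + 1)).sigma fun p => Finset.range (n - p + 1))
    (fun t => shiftedWeight h (boxWeight n t.1 t.2))
    (fun t _ => shiftedWeight_strictAnti h (boxWeight_antitone t.1 t.2))
    (fun t _ => shiftedWeight_pos hh (boxWeight_nonneg t.1 t.2))
    (fun t ht t' ht' e => by
      obtain ⟨p, q⟩ := t
      obtain ⟨p', q'⟩ := t'
      simp only [Finset.coe_sigma, Set.mem_sigma_iff, Finset.coe_range, Set.mem_Iio] at ht ht'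
      obtain ⟨rfl, rfl⟩ :=
        boxWeight_injective (p := p) (q := q) (p' := p') (q' := q') (by omega) (by omega)
          (shiftedWeight_injective h e)
      rfl)
    (fun t => ψ t.2 (n - t.1 - t.2)) (fun t => ψ' t.2 (n - t.1 - t.2)) (H.symm.trans H')
    ⟨n - q - r, q⟩ (by simp; omega)
  have e : n - (n - q - r) - q = r := by omega
  simpa only [e] using key

end Expansions

/-! ### Characters, Weyl denominators and the spin factor -/

section Characters

open Matrix

variable {K : Type*} [Field K] {n : ℕ}

theorem chSp_eq (κ : Fin n → ℚ) :
    chSp K κ = signedSum (signCoeff K n (-1)) (shiftedWeight 1 κ) /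
      signedSum (signCoeff K n (-1)) (shiftedWeight 1 0) := by
  rw [chSp, weylChar, alternant_eq_signedSum .sp rfl, alternant_eq_signedSum .sp rfl,
    signCoeff_neg_one]
  congr 2 <;> ext i <;> simp only [Pi.add_apply, Pi.zero_apply, weylVector, shiftedWeight] <;> ring

theorem chSOodd_eq (κ : Fin n → ℚ) :
    chSOodd K κ = signedSum (signCoeff K n (-1)) (shiftedWeight (1 / 2) κ) /
      signedSum (signCoeff K n (-1)) (shiftedWeight (1 / 2) 0) := by
  rw [chSOodd, weylChar, alternant_eq_signedSum .soOdd rfl, alternant_eq_signedSum .soOdd rfl,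
    signCoeff_neg_one]
  congr 2 <;> ext i <;> simp only [Pi.add_apply, Pi.zero_apply, weylVector, shiftedWeight] <;> ring

/-- The spin weight raises the shift from 1/2 to 1, which produces the numerator of Sp(2n) over the
denominator of SO(2n+1). -/
theorem chSOodd_spin_eq (κ : Fin n → ℚ) :
    chSOodd K (spinWeight n + κ) = signedSum (signCoeff K n (-1)) (shiftedWeight 1 κ) /
      signedSum (signCoeff K n (-1)) (shiftedWeight (1 / 2) 0) := by
  rw [chSOodd_eq]
  congr 2
  ext i
  simp only [Pi.add_apply, spinWeight, shiftedWeight]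
  ring

theorem weylVector_soEven_last : weylVector .soEven (n + 1) (Fin.last n) = 0 := by
  simp [weylVector]

/-- The last component is at least 1/2, so the character has two summands. Because ρ ends in 0,
negating the last component commutes with adding ρ, and the numerators combine. -/
theorem chOeven_spin_eq (p q : ℕ) :
    chOeven K (spinWeight (n + 1) + boxWeight (n + 1) p q) =
      signedSum (signCoeff K (n + 1) 1) (shiftedWeight (1 / 2) (boxWeight (n + 1) p q)) /
        alternant K .soEven (weylVector .soEven (n + 1)) := by
  have hne : negLast (spinWeight (n + 1) + boxWeight (n + 1) p q) ≠
      spinWeight (n + 1) + boxWeight (n + 1) p q := by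
    intro h
    have h1 := congrFun h (Fin.last n)
    have h2 := boxWeight_nonneg p q (Fin.last n)
    simp only [negLast_apply, if_true, Pi.add_apply, spinWeight] at h1
    linarith
  have hneg : negLast (spinWeight (n + 1) + boxWeight (n + 1) p q) + weylVector .soEven (n + 1) =
      negLast (spinWeight (n + 1) + boxWeight (n + 1) p q + weylVector .soEven (n + 1)) := by
    ext i
    simp only [negLast_apply, Pi.add_apply]
    split_ifs with hi
    · rw [hi, weylVector_soEven_last]; ring
    · rfl
  rw [chOeven, if_neg hne, weylChar, weylChar, ← add_div, hneg, alternant_soEven_add_negLast,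
    signCoeff_one]
  congr 2
  ext i
  simp only [Pi.add_apply, spinWeight, weylVector, shiftedWeight]
  push_cast
  ring

theorem signedSum_shiftedWeight_ne_zero {h : ℚ} (hh : 0 < h) (η : K) :
    signedSum (signCoeff K n η) (shiftedWeight h 0) ≠ 0 := by
  rw [← boxWeight_zero]
  exact signedSum_ne_zero _ (by simp [signCoeff])
    (shiftedWeight_strictAnti h (boxWeight_antitone 0 0))
    (shiftedWeight_pos hh (boxWeight_nonneg 0 0))

theorem xPow_injective (i : Fin n) : Function.Injective (xPow K i) := by
  intro k l h
  have h1 := IsFractionRing.injective (AddMonoidAlgebra K (Fin n → ℚ)) (CharField K n) h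
  have h2 := congrArg AddMonoidAlgebra.coeff h1
  rw [AddMonoidAlgebra.coeff_single, AddMonoidAlgebra.coeff_single] at h2
  exact Pi.single_injective i (Finsupp.single_left_injective one_ne_zero h2)

/-- Monic polynomials with value `x^k + x^{-k}` at `x + x⁻¹`, except that the first one is `1`. -/
noncomputable def symFamily (K : Type*) [Field K] : ℕ → Polynomial K
  | 0 => 1
  | k + 1 => chebFamily 1 (k + 1) - chebFamily 1 k

theorem symFamily_monic_natDegree (k : ℕ) :
    (symFamily K k).Monic ∧ (symFamily K k).natDegree = k := by
  cases k with
  | zero => simp [symFamily]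
  | succ k =>
    have h₀ := chebFamily_monic_natDegree (1 : K) k
    have h₁ := chebFamily_monic_natDegree (1 : K) (k + 1)
    have hlt : (chebFamily (1 : K) k).natDegree < (chebFamily (1 : K) (k + 1)).natDegree := by
      rw [h₀.2, h₁.2]; omega
    refine ⟨h₁.1.sub_of_left (Polynomial.degree_lt_degree hlt), ?_⟩
    rw [symFamily, Polynomial.natDegree_sub_eq_left_of_natDegree_lt hlt, h₁.2]

theorem aeval_symFamily_succ (i : Fin n) (k : ℕ) :
    Polynomial.aeval (xSym K i 1) (symFamily K (k + 1)) = xSym K i (k + 1) := by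
  -- Nonzero in every characteristic, being a difference of two distinct monomials.
  have h0 : xTwist i (-1 : K) (1 / 2) ≠ 0 := by
    intro h
    rw [xTwist, neg_one_smul, add_neg_eq_zero] at h
    have := xPow_injective i h
    norm_num at this
  apply mul_right_cancel₀ h0
  rw [symFamily, map_sub, sub_mul, xTwist_eq_aeval i _ _ _ (xTwist_boundary_soOdd i),
    xTwist_eq_aeval i _ _ _ (xTwist_boundary_soOdd i), xSym_mul_xTwist]
  simp only [xTwist]
  push_cast
  rw [show (1 / 2 - ((k : ℚ) + 1)) = -(k + 1 / 2) by ring,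
    show (1 / 2 + ((k : ℚ) + 1)) = k + 1 + 1 / 2 by ring, neg_neg]
  simp only [neg_smul, one_smul]
  ring

/-- The Weyl denominator of `SO(2n)` is a Vandermonde determinant. -/
theorem alternant_soEven_weylVector :
    alternant K .soEven (weylVector .soEven (n + 1)) =
      ((Equiv.Perm.sign (Fin.revPerm : Equiv.Perm (Fin (n + 1))) : ℤ) : CharField K (n + 1)) *
        det (vandermonde fun i => xSym K i 1) := by
  rw [alternant_soEven_of_last_eq_zero _ weylVector_soEven_last, signedSum_eq_det,
    ← polyDet_val (symFamily K) (fun k => (symFamily_monic_natDegree k).1)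
      (fun k => (symFamily_monic_natDegree k).2), ← polyDet_comp_rev _ _ (fun j => j), polyDet]
  congr 1
  ext i j
  simp only [of_apply]
  have h1 : (-1 : ℤˣ) ≠ 1 := by decide
  refine Fin.lastCases ?_ (fun j => ?_) j
  -- The nontrivial sign has coefficient 0 in the last column, so its entries are 1 and not 2,
  -- matching the first member of `symFamily`.
  · simp [weylVector_soEven_last, symFamily, xMonomial_zero, h1]
  · obtain ⟨k, hk⟩ := Nat.exists_eq_add_of_lt j.2
    have h2 : ((Fin.rev j.castSucc : Fin (n + 1)) : ℕ) = k + 1 := by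
      simp only [Fin.val_rev, Fin.val_castSucc]; omega
    have h3 : weylVector .soEven (n + 1) j.castSucc = k + 1 := by
      have : (n : ℚ) = (j : ℕ) + k + 1 := by exact_mod_cast hk
      simp only [weylVector, Fin.val_castSucc]
      push_cast
      linarith
    rw [h2, h3, aeval_symFamily_succ]
    simp [xSym, Fin.castSucc_ne_last]

/-- Factor by factor, (x^{1/2} + x^{-1/2})(x^{1/2} - x^{-1/2}) = x - x⁻¹. -/
theorem prod_xSym_half_mul_soOdd :
    (∏ i : Fin n, xSym K i (1 / 2)) * signedSum (signCoeff K n (-1)) (shiftedWeight (1 / 2) 0) =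
      signedSum (signCoeff K n (-1)) (shiftedWeight 1 0) := by
  rw [signedSum_shiftedWeight_zero (-1) 1 (1 / 2) xTwist_boundary_soOdd,
    signedSum_shiftedWeight_zero (-1) 0 1 xTwist_boundary_sp, ← mul_assoc,
    ← Finset.prod_mul_distrib]
  congr 1
  refine Finset.prod_congr rfl fun i _ => ?_
  rw [xSym_mul_xTwist, sub_self]
  norm_num [xTwist]

theorem prod_xSym_half_mul_soEven :
    (∏ i : Fin (n + 1), xSym K i (1 / 2)) * alternant K .soEven (weylVector .soEven (n + 1)) =
      signedSum (signCoeff K (n + 1) 1) (shiftedWeight (1 / 2) 0) := by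
  rw [signedSum_shiftedWeight_zero 1 (-1) (1 / 2) xTwist_boundary_spin, alternant_soEven_weylVector]
  simp only [xTwist_one]

/-- The last component of ρ is 0, outside the scope of `signedSum_ne_zero`; a multiple of this
denominator is within it. -/
theorem alternant_soEven_weylVector_ne_zero :
    alternant K .soEven (weylVector .soEven (n + 1)) ≠ 0 := by
  refine right_ne_zero_of_mul (a := ∏ i : Fin (n + 1), xSym K i (1 / 2)) ?_
  rw [prod_xSym_half_mul_soEven]
  exact signedSum_shiftedWeight_ne_zero (by norm_num) 1

theorem xSym_neg (i : Fin n) (k : ℚ) : xSym K i (-k) = xSym K i k := by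
  rw [xSym_eq, xSym_eq, neg_neg, add_comm]

theorem xSym_mul_half (i : Fin n) (l : ℚ) :
    xSym K i l * xSym K i (1 / 2) = xSym K i (l + 1 / 2) + xSym K i (l - 1 / 2) := by
  have := xSym_mul_xTwist i (1 : K) (1 / 2) l
  rw [xTwist_one, xTwist_one, xTwist_one] at this
  rw [this, ← xSym_neg i (l - 1 / 2), neg_sub, add_comm l]

/-- From x^{3/2} + x^{-3/2} = (x^{1/2} + x^{-1/2})(x + x⁻¹ - 1); this is where the parameter shift a
- 1 originates. -/
theorem spin_linear_factor (i : Fin n) (a : K) :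
    a • xSym K i (1 / 2) + (1 : K) • xSym K i (3 / 2) =
      xSym K i (1 / 2) * ((a - 1) • 1 + xSym K i 1) := by
  have h := xSym_mul_half (K := K) i 1
  norm_num at h
  simp only [Algebra.smul_def, map_sub, map_one]
  norm_num
  linear_combination -h

theorem spin_quadratic_factor (i : Fin n) (a b : K) :
    a • xSym K i (1 / 2) + b • xSym K i (3 / 2) + (1 : K) • xSym K i (5 / 2) =
      xSym K i (1 / 2) * ((a - b + 1) • 1 + (b - 1) • xSym K i 1 + xSym K i 2) := by
  have h := xSym_mul_half (K := K) i 1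
  have h2 := xSym_mul_half (K := K) i 2
  norm_num at h h2
  simp only [Algebra.smul_def, map_sub, map_add, map_one]
  norm_num
  linear_combination (1 - algebraMap K (CharField K n) b) * h - h2

theorem isPhi_chSp_iff (a : K) (φ : ℕ → K) :
    IsPhi (n := n) (chSp K) a 1 φ ↔ LinearExpansion n 1 (-1) a φ := by
  simp only [IsPhi, LinearExpansion, chSp_eq, ← smul_div_assoc, ← Finset.sum_div, one_pow, one_mul,
    one_smul]
  rw [eq_div_iff (signedSum_shiftedWeight_ne_zero (by norm_num) _)]

theorem isPhi_chSOodd_iff (a : K) (φ : ℕ → K) :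
    IsPhi (n := n) (chSOodd K) a 1 φ ↔ LinearExpansion n (1 / 2) (-1) a φ := by
  simp only [IsPhi, LinearExpansion, chSOodd_eq, ← smul_div_assoc, ← Finset.sum_div, one_pow,
    one_mul, one_smul]
  rw [eq_div_iff (signedSum_shiftedWeight_ne_zero (by norm_num) _)]

theorem isPsi_chSp_iff (a b : K) (ψ : ℕ → ℕ → K) :
    IsPsi (n := n) (chSp K) a b 1 ψ ↔ QuadraticExpansion n 1 (-1) a b ψ := by
  simp only [IsPsi, QuadraticExpansion, chSp_eq, ← smul_div_assoc, ← Finset.sum_div, one_pow,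
    one_mul, one_smul]
  rw [eq_div_iff (signedSum_shiftedWeight_ne_zero (by norm_num) _)]

theorem isPsi_chSOodd_iff (a b : K) (ψ : ℕ → ℕ → K) :
    IsPsi (n := n) (chSOodd K) a b 1 ψ ↔ QuadraticExpansion n (1 / 2) (-1) a b ψ := by
  simp only [IsPsi, QuadraticExpansion, chSOodd_eq, ← smul_div_assoc, ← Finset.sum_div, one_pow,
    one_mul, one_smul]
  rw [eq_div_iff (signedSum_shiftedWeight_ne_zero (by norm_num) _)]

/-- The factor ∏ (x_i^{1/2} + x_i^{-1/2}) of the product is absorbed into the denominator, so the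
spin expansion is literally an Sp(2n) expansion. -/
theorem isSpinPhi_chSOodd_iff (a : K) (φ : ℕ → K) :
    IsSpinPhi (n := n) (chSOodd K) a 1 φ ↔ LinearExpansion n 1 (-1) (a - 1) φ := by
  simp only [IsSpinPhi, LinearExpansion, chSOodd_spin_eq, ← smul_div_assoc, ← Finset.sum_div,
    one_pow, one_mul, spin_linear_factor]
  rw [eq_div_iff (signedSum_shiftedWeight_ne_zero (by norm_num) _), Finset.prod_mul_distrib,
    mul_right_comm, prod_xSym_half_mul_soOdd, mul_comm]

theorem isSpinPsi_chSOodd_iff (a b : K) (ψ : ℕ → ℕ → K) :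
    IsSpinPsi (n := n) (chSOodd K) a b 1 ψ ↔
      QuadraticExpansion n 1 (-1) (a - b + 1) (b - 1) ψ := by
  simp only [IsSpinPsi, QuadraticExpansion, chSOodd_spin_eq, ← smul_div_assoc, ← Finset.sum_div,
    one_pow, one_mul, spin_quadratic_factor]
  rw [eq_div_iff (signedSum_shiftedWeight_ne_zero (by norm_num) _), Finset.prod_mul_distrib,
    mul_right_comm, prod_xSym_half_mul_soOdd, mul_comm]

theorem isSpinPhi_chOeven_iff (hn : 0 < n) (a : K) (φ : ℕ → K) :
    IsSpinPhi (n := n) (chOeven K) a 1 φ ↔ LinearExpansion n (1 / 2) 1 (a - 1) φ := by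
  obtain ⟨n, rfl⟩ := Nat.exists_eq_succ_of_ne_zero hn.ne'
  simp only [IsSpinPhi, LinearExpansion, chOeven_spin_eq, ← smul_div_assoc, ← Finset.sum_div,
    one_pow, one_mul, spin_linear_factor, Nat.succ_eq_add_one]
  rw [eq_div_iff alternant_soEven_weylVector_ne_zero, Finset.prod_mul_distrib,
    mul_right_comm, prod_xSym_half_mul_soEven, mul_comm]

theorem isSpinPsi_chOeven_iff (hn : 0 < n) (a b : K) (ψ : ℕ → ℕ → K) :
    IsSpinPsi (n := n) (chOeven K) a b 1 ψ ↔
      QuadraticExpansion n (1 / 2) 1 (a - b + 1) (b - 1) ψ := by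
  obtain ⟨n, rfl⟩ := Nat.exists_eq_succ_of_ne_zero hn.ne'
  simp only [IsSpinPsi, QuadraticExpansion, chOeven_spin_eq, ← smul_div_assoc, ← Finset.sum_div,
    one_pow, one_mul, spin_quadratic_factor, Nat.succ_eq_add_one]
  rw [eq_div_iff alternant_soEven_weylVector_ne_zero, Finset.prod_mul_distrib,
    mul_right_comm, prod_xSym_half_mul_soEven, mul_comm]

/-! ### Existence, uniqueness and the relations -/

theorem existsUnique_linearExpansion {h : ℚ} (hh : 0 < h) (η ε a : K)
    (hε : ∀ (n : ℕ) (i : Fin n), xTwist i η (h - 1) + ε • xTwist i η h = 0) :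
    ∃! φ : ℕ → K, ∀ n : ℕ, 0 < n → LinearExpansion n h η a φ := by
  refine ⟨linearCoeff ε a, fun n _ => linearExpansion_linearCoeff η ε h a (hε n), fun φ hφ => ?_⟩
  ext r
  -- Rank r + 1 is positive even for r = 0 and large enough to determine the coefficient at r.
  exact (hφ (r + 1) r.succ_pos).unique hh
    (linearExpansion_linearCoeff η ε h a (hε (r + 1))) r (by omega)

theorem existsUnique_quadraticExpansion {h : ℚ} (hh : 0 < h) (η ε a b : K)
    (hε : ∀ (n : ℕ) (i : Fin n), xTwist i η (h - 1) + ε • xTwist i η h = 0) :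
    ∃! ψ : ℕ → ℕ → K, ∀ n : ℕ, 0 < n → QuadraticExpansion n h η a b ψ := by
  refine ⟨quadraticCoeff ε a b,
    fun n _ => quadraticExpansion_quadraticCoeff η ε h a b (hε n), fun ψ hψ => ?_⟩
  ext q r
  exact (hψ (q + r + 1) (q + r).succ_pos).unique hh
    (quadraticExpansion_quadraticCoeff η ε h a b (hε (q + r + 1))) q r (by omega)

theorem linearCoeff_neg (a : K) (r : ℕ) :
    linearCoeff (-1) a r = (-1) ^ r * linearCoeff 1 (-a) r := by
  simp [linearCoeff, chebFamily_neg, Polynomial.eval_comp]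

theorem quadraticCoeff_neg (a b : K) (q r : ℕ) :
    quadraticCoeff (-1) a b q r = (-1) ^ q * quadraticCoeff 1 a (-b) q r := by
  rw [quadraticCoeff, quadraticCoeff, ← quadCoeff_chebFamily_neg 1 _ (quadPoly_monic a (-b))
    (quadPoly_natDegree a (-b)), quadPoly_comp_neg, neg_neg]

end Characters

theorem mainTheorem10 {K : Type*} [Field K] :
    -- the expansion coefficients exist, are unique and do not depend on the rank `n`
    ((∀ a : K, ∃! φ : ℕ → K, ∀ n : ℕ, 0 < n → IsPhi (n := n) (chSp K) a 1 φ) ∧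
      (∀ a : K, ∃! φ : ℕ → K, ∀ n : ℕ, 0 < n → IsPhi (n := n) (chSOodd K) a 1 φ) ∧
      (∀ a : K, ∃! φ : ℕ → K, ∀ n : ℕ, 0 < n → IsSpinPhi (n := n) (chSOodd K) a 1 φ) ∧
      (∀ a : K, ∃! φ : ℕ → K, ∀ n : ℕ, 0 < n → IsSpinPhi (n := n) (chOeven K) a 1 φ) ∧
      (∀ a b : K, ∃! ψ : ℕ → ℕ → K, ∀ n : ℕ, 0 < n → IsPsi (n := n) (chSp K) a b 1 ψ) ∧
      (∀ a b : K, ∃! ψ : ℕ → ℕ → K, ∀ n : ℕ, 0 < n → IsPsi (n := n) (chSOodd K) a b 1 ψ) ∧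
      (∀ a b : K, ∃! ψ : ℕ → ℕ → K, ∀ n : ℕ, 0 < n → IsSpinPsi (n := n) (chSOodd K) a b 1 ψ) ∧
      (∀ a b : K, ∃! ψ : ℕ → ℕ → K, ∀ n : ℕ, 0 < n → IsSpinPsi (n := n) (chOeven K) a b 1 ψ)) ∧
    -- the relations between them, for every rank `n`
    (∀ n : ℕ, 0 < n → ∀ (a : K) (φ φ' : ℕ → K),
      IsSpinPhi (n := n) (chSOodd K) a 1 φ → IsPhi (n := n) (chSp K) (a - 1) 1 φ' →
        ∀ r ≤ n, φ r = φ' r) ∧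
    (∀ n : ℕ, 0 < n → ∀ (a : K) (φ φ' : ℕ → K),
      IsSpinPhi (n := n) (chOeven K) a 1 φ → IsPhi (n := n) (chSOodd K) (-a + 1) 1 φ' →
        ∀ r ≤ n, φ r = (-1) ^ r * φ' r) ∧
    (∀ n : ℕ, 0 < n → ∀ (a b : K) (ψ ψ' : ℕ → ℕ → K),
      IsSpinPsi (n := n) (chSOodd K) a b 1 ψ →
      IsPsi (n := n) (chSp K) (a - b + 1) (b - 1) 1 ψ' →
        ∀ q r : ℕ, q + r ≤ n → ψ q r = ψ' q r) ∧
    (∀ n : ℕ, 0 < n → ∀ (a b : K) (ψ ψ' : ℕ → ℕ → K),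
      IsSpinPsi (n := n) (chOeven K) a b 1 ψ →
      IsPsi (n := n) (chSOodd K) (a - b + 1) (-b + 1) 1 ψ' →
        ∀ q r : ℕ, q + r ≤ n → ψ q r = (-1) ^ q * ψ' q r) := by
  refine ⟨⟨fun a => ?_, fun a => ?_, fun a => ?_, fun a => ?_, fun a b => ?_, fun a b => ?_,
    fun a b => ?_, fun a b => ?_⟩, fun n _ a φ φ' h h' => ?_, fun n hn a φ φ' h h' r hr => ?_,
    fun n _ a b ψ ψ' h h' => ?_, fun n hn a b ψ ψ' h h' q r hqr => ?_⟩
  · simp only [isPhi_chSp_iff]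
    exact existsUnique_linearExpansion one_pos _ 0 a fun _ => xTwist_boundary_sp
  · simp only [isPhi_chSOodd_iff]
    exact existsUnique_linearExpansion one_half_pos _ 1 a fun _ => xTwist_boundary_soOdd
  · simp only [isSpinPhi_chSOodd_iff]
    exact existsUnique_linearExpansion one_pos _ 0 _ fun _ => xTwist_boundary_sp
  · simp +contextual only [isSpinPhi_chOeven_iff]
    exact existsUnique_linearExpansion one_half_pos _ (-1) _ fun _ => xTwist_boundary_spin
  · simp only [isPsi_chSp_iff]
    exact existsUnique_quadraticExpansion one_pos _ 0 a b fun _ => xTwist_boundary_sp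
  · simp only [isPsi_chSOodd_iff]
    exact existsUnique_quadraticExpansion one_half_pos _ 1 a b fun _ => xTwist_boundary_soOdd
  · simp only [isSpinPsi_chSOodd_iff]
    exact existsUnique_quadraticExpansion one_pos _ 0 _ _ fun _ => xTwist_boundary_sp
  · simp +contextual only [isSpinPsi_chOeven_iff]
    exact existsUnique_quadraticExpansion one_half_pos _ (-1) _ _ fun _ => xTwist_boundary_spin
  · rw [isSpinPhi_chSOodd_iff] at h
    rw [isPhi_chSp_iff] at h'
    exact h.unique one_pos h'
  · rw [isSpinPhi_chOeven_iff hn] at h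
    rw [isPhi_chSOodd_iff] at h'
    -- The two expansions differ in η, so uniqueness does not compare them directly; each is matched
    -- with its explicit coefficients, which ε ↦ -ε relates.
    rw [h.unique one_half_pos
        (linearExpansion_linearCoeff 1 (-1) (1 / 2) (a - 1) xTwist_boundary_spin) r hr,
      h'.unique one_half_pos
        (linearExpansion_linearCoeff (-1) 1 (1 / 2) (-a + 1) xTwist_boundary_soOdd) r hr,
      linearCoeff_neg, neg_sub, neg_add_eq_sub]
  · rw [isSpinPsi_chSOodd_iff] at h
    rw [isPsi_chSp_iff] at h'
    exact h.unique one_pos h'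
  · rw [isSpinPsi_chOeven_iff hn] at h
    rw [isPsi_chSOodd_iff] at h'
    rw [h.unique one_half_pos (quadraticExpansion_quadraticCoeff 1 (-1) (1 / 2) (a - b + 1) (b - 1)
        xTwist_boundary_spin) q r hqr,
      h'.unique one_half_pos (quadraticExpansion_quadraticCoeff (-1) 1 (1 / 2) (a - b + 1) (-b + 1)
        xTwist_boundary_soOdd) q r hqr,
      quadraticCoeff_neg, neg_sub, neg_add_eq_sub]
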